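/- Let $K$ be a number field, let $G \subset \mathrm{GL}_m$ be a linear algebraic group defined over $K$ (given with a faithful $K$-defined representation; for instance an absolutely almost simple simply connected one), let $S$ be a set of places of $K$ containing all archimedean places, let $\mathcal{O}(S)$ be the ring of $S$-integers of $K$, and put $\Gamma = G(\mathcal{O}(S)) = G(K) \cap \mathrm{GL}_m(\mathcal{O}(S))$. For a nonzero ideal $\mathfrak{a} \subset \mathcal{O}(S)$ let $G(\mathcal{O}(S),\mathfrak{a})$ be the group of all elements of $\Gamma$ that are congruent to the identity matrix modulo $\mathfrak{a}$. Let $\widehat{G}^S$ and $\overline{G}^S$ be the (Hausdorff) completions of the group $G(K)$ with respect to the $S$-arithmetic topology, for which the finite index subgroups of $\Gamma$ form a fundamental system of neighborhoods of the identity, and the $S$-congruence topology, for which the congruence subgroups $G(\mathcal{O}(S),\mathfrak{a})$, $\mathfrak{a} \neq 0$, form such a system. Let $\pi \colon \widehat{G}^S \to \overline{G}^S$ be the continuous homomorphism that extends the identity map of $G(K)$, and let $C^S(G) = \ker \pi$ be the congruence kernel. For a subgroup $N$ of $\Gamma$, let $\overline{N}$ be its closure in $\overline{G}^S$, let $\overline{N}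 \cap \Gamma$ be the set of all elements of $\Gamma$ whose image in $\overline{G}^S$ lies in $\overline{N}$, and for $y \in \Gamma$ put $Z(N,y) = \{ t \in \Gamma \mid [y,t] \in N \}$, where $[y,t] = y t y^{-1} t^{-1}$. Finally, let $\Gamma^n = \{ \gamma^n \mid \gamma \in \Gamma \}$. Let $n \geq 1$. Assume that for every finite index normal subgroup $N$ of $\Gamma$ and every $y \in \overline{N} \cap \Gamma$ we have the inclusion $$Z(N,y)\,(\overline{N} \cap \Gamma) \supset \Gamma^n .$$ Then for every $x \in C^S(G)$ we have $$\pi\bigl(Z_{\widehat{G}^S}(x)\bigr) \supset \Gamma^n ,$$ where $Z_{\widehat{G}^S}(x)$ is the centralizer of $x$ in $\widehat{G}^S$ and $\Gamma^n$ is identified with its image in $\overline{G}^S$. -/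

import Mathlib

section Completion

open Filter Topology

variable (H : Type*) [Group H] [TopologicalSpace H] [IsTopologicalGroup H]

/-- The two-sided uniform structure of a topological group: the infimum of the left and the right
uniform structures. -/
abbrev twoSidedUniformSpace : UniformSpace H :=
  (IsTopologicalGroup.leftUniformSpace H ⊓ IsTopologicalGroup.rightUniformSpace H).replaceTopology
    (by rw [UniformSpace.toTopologicalSpace_inf]; exact (inf_idem _).symm)

/-- The (Hausdorff) completion of a topological group, that is, its completion with respect to the
two-sided uniform structure. -/
def GroupCompletion : Type _ := @UniformSpace.Completion H (twoSidedUniformSpace H)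

namespace GroupCompletion

attribute [local instance] twoSidedUniformSpace

instance : UniformSpace (GroupCompletion H) :=
  inferInstanceAs (UniformSpace (UniformSpace.Completion H))

instance : CompleteSpace (GroupCompletion H) :=
  inferInstanceAs (CompleteSpace (UniformSpace.Completion H))

instance : T0Space (GroupCompletion H) :=
  inferInstanceAs (T0Space (UniformSpace.Completion H))

variable {H}

/-- The canonical map from a topological group to its completion. -/
def ofFun (h : H) : GroupCompletion H := UniformSpace.Completion.coe' h

lemma isUniformInducing_ofFun : IsUniformInducing (ofFun : H → GroupCompletion H) :=
  UniformSpace.Completion.isUniformInducing_coe H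

lemma denseRange_ofFun : DenseRange (ofFun : H → GroupCompletion H) :=
  UniformSpace.Completion.denseRange_coe

lemma isDenseInducing_ofFun : IsDenseInducing (ofFun : H → GroupCompletion H) :=
  isUniformInducing_ofFun.isDenseInducing denseRange_ofFun

lemma cauchy_iff' (F : Filter H) : Cauchy F ↔ F.NeBot ∧
    Tendsto (fun p : H × H => p.1⁻¹ * p.2) (F ×ˢ F) (𝓝 1) ∧
    Tendsto (fun p : H × H => p.2 * p.1⁻¹) (F ×ˢ F) (𝓝 1) := by
  have : uniformity H = comap (fun p : H × H => p.1⁻¹ * p.2) (𝓝 1) ⊓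
      comap (fun p : H × H => p.2 * p.1⁻¹) (𝓝 1) := rfl
  rw [Cauchy, this, le_inf_iff, ← tendsto_iff_comap, ← tendsto_iff_comap]

lemma cauchy_inv {F : Filter H} (hF : Cauchy F) : Cauchy (map (fun h => h⁻¹) F) := by
  rw [cauchy_iff'] at hF ⊢
  obtain ⟨h0, h1, h2⟩ := hF
  refine ⟨h0.map _, ?_, ?_⟩
  · rw [prod_map_map_eq, tendsto_map'_iff]
    simpa [Function.comp_def] using h2.inv
  · rw [prod_map_map_eq, tendsto_map'_iff]
    simpa [Function.comp_def] using h1.inv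

/-- Conjugating a small element by the members of a Cauchy filter keeps it small. -/
lemma exists_conj {G : Filter H} (hG : Cauchy G) {V : Set H} (hV : V ∈ 𝓝 (1 : H)) :
    ∃ W ∈ 𝓝 (1 : H), ∀ᶠ y in G, ∀ w ∈ W, y⁻¹ * w * y ∈ V ∧ y * w * y⁻¹ ∈ V := by
  obtain ⟨h0, h1, h2⟩ := (cauchy_iff' G).1 hG
  have hc : Tendsto (fun p : H × H => p.1⁻¹ * p.2 * p.1) (𝓝 1 ×ˢ 𝓝 1) (𝓝 1) := by
    have : ContinuousAt (fun p : H × H => p.1⁻¹ * p.2 * p.1) (1, 1) := by fun_prop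
    simpa [ContinuousAt, nhds_prod_eq] using this
  obtain ⟨A, hA, B, hB, hAB⟩ := mem_prod_iff.1 (hc hV)
  have e1 : ∀ᶠ p : H × H in G ×ˢ G, p.1⁻¹ * p.2 ∈ A := h1 hA
  have e2 : ∀ᶠ p : H × H in G ×ˢ G, (p.2 * p.1⁻¹)⁻¹ ∈ A := by
    have := h2.inv
    rw [inv_one] at this
    exact this hA
  obtain ⟨y₀, hy₀⟩ := (e1.and e2).curry.exists
  have c1 : ∀ᶠ w in 𝓝 (1 : H), y₀⁻¹ * w * y₀ ∈ B := by
    have : Tendsto (fun w => y₀⁻¹ * w * y₀) (𝓝 1) (𝓝 (y₀⁻¹ * 1 * y₀)) :=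
      (by fun_prop : Continuous fun w => y₀⁻¹ * w * y₀).tendsto 1
    rw [mul_one, inv_mul_cancel] at this
    exact this hB
  have c2 : ∀ᶠ w in 𝓝 (1 : H), y₀ * w * y₀⁻¹ ∈ B := by
    have : Tendsto (fun w => y₀ * w * y₀⁻¹) (𝓝 1) (𝓝 (y₀ * 1 * y₀⁻¹)) :=
      (by fun_prop : Continuous fun w => y₀ * w * y₀⁻¹).tendsto 1
    rw [mul_one, mul_inv_cancel] at this
    exact this hB
  refine ⟨_, c1.and c2, hy₀.mono fun y hy w hw => ⟨?_, ?_⟩⟩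
  · have := hAB (Set.mk_mem_prod hy.1 hw.1)
    simpa [mul_assoc] using this
  · have := hAB (Set.mk_mem_prod hy.2 hw.2)
    simpa [mul_assoc] using this

lemma cauchy_mul {F G : Filter H} (hF : Cauchy F) (hG : Cauchy G) :
    Cauchy (map (fun p : H × H => p.1 * p.2) (F ×ˢ G)) := by
  have hF' := (cauchy_iff' F).1 hF
  have hG' := (cauchy_iff' G).1 hG
  have := hF'.1
  have := hG'.1
  rw [cauchy_iff']
  refine ⟨inferInstance, ?_, ?_⟩
  all_goals
    rw [prod_map_map_eq, tendsto_map'_iff]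
    intro U hU
    obtain ⟨V, hV, hVU⟩ := exists_nhds_one_split hU
  · obtain ⟨W, hW, hc⟩ := exists_conj hG hV
    have a1 : ∀ᶠ q : (H × H) × (H × H) in (F ×ˢ G) ×ˢ (F ×ˢ G), q.1.1⁻¹ * q.2.1 ∈ W :=
      (tendsto_fst.prodMap tendsto_fst).eventually (hF'.2.1 hW)
    have a2 : ∀ᶠ q : (H × H) × (H × H) in (F ×ˢ G) ×ˢ (F ×ˢ G), q.1.2⁻¹ * q.2.2 ∈ V :=
      (tendsto_snd.prodMap tendsto_snd).eventually (hG'.2.1 hV)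
    have a3 := (tendsto_snd.comp (tendsto_fst (f := F ×ˢ G) (g := F ×ˢ G))).eventually hc
    rw [mem_map]
    filter_upwards [a1, a2, a3] with q h1 h2 h3
    have := hVU _ (h3 _ h1).1 _ h2
    simpa [mul_assoc] using this
  · obtain ⟨W, hW, hc⟩ := exists_conj hF hV
    have a1 : ∀ᶠ q : (H × H) × (H × H) in (F ×ˢ G) ×ˢ (F ×ˢ G), q.2.2 * q.1.2⁻¹ ∈ W :=
      (tendsto_snd.prodMap tendsto_snd).eventually (hG'.2.2 hW)
    have a2 : ∀ᶠ q : (H × H) × (H × H) in (F ×ˢ G) ×ˢ (F ×ˢ G), q.2.1 * q.1.1⁻¹ ∈ V :=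
      (tendsto_fst.prodMap tendsto_fst).eventually (hF'.2.2 hV)
    have a3 := (tendsto_fst.comp (tendsto_fst (f := F ×ˢ G) (g := F ×ˢ G))).eventually hc
    rw [mem_map]
    filter_upwards [a1, a2, a3] with q h1 h2 h3
    have := hVU _ h2 _ (h3 _ h1).2
    simpa [mul_assoc] using this

lemma cauchy_comap_ofFun (x : GroupCompletion H) : Cauchy (comap (ofFun : H → _) (𝓝 x)) :=
  cauchy_nhds.comap' isUniformInducing_ofFun.comap_uniformity.le
    (isDenseInducing_ofFun.comap_nhds_neBot x)

lemma exists_tendsto {α : Type*} {f : α → H} {F : Filter α} (h : Cauchy (map f F)) :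
    ∃ c, Tendsto (fun a => ofFun (f a)) F (𝓝 c) := by
  obtain ⟨c, hc⟩ := CompleteSpace.complete
    (h.map isUniformInducing_ofFun.uniformContinuous)
  exact ⟨c, by rwa [map_map] at hc⟩

instance : One (GroupCompletion H) := ⟨ofFun 1⟩

/-- Inversion and multiplication are the continuous extensions of those of the group. -/
noncomputable instance : Inv (GroupCompletion H) :=
  ⟨isDenseInducing_ofFun.extend fun h => ofFun h⁻¹⟩

noncomputable instance : Mul (GroupCompletion H) :=
  ⟨fun x y => (isDenseInducing_ofFun.prodMap isDenseInducing_ofFun).extend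
    (fun p : H × H => ofFun (p.1 * p.2)) (x, y)⟩

instance : ContinuousInv (GroupCompletion H) where
  continuous_inv := isDenseInducing_ofFun.continuous_extend fun x =>
    exists_tendsto (cauchy_inv (cauchy_comap_ofFun x))

instance : ContinuousMul (GroupCompletion H) where
  continuous_mul := (isDenseInducing_ofFun.prodMap isDenseInducing_ofFun).continuous_extend
    fun x => exists_tendsto (f := fun p : H × H => p.1 * p.2) (by
      have : comap (Prod.map ofFun ofFun) (𝓝 x) =
          comap (ofFun : H → _) (𝓝 x.1) ×ˢ comap (ofFun : H → _) (𝓝 x.2) := by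
        rw [nhds_prod_eq, prod_comap_comap_eq]; rfl
      rw [this]
      exact cauchy_mul (cauchy_comap_ofFun _) (cauchy_comap_ofFun _))

lemma continuous_ofFun : Continuous (ofFun : H → GroupCompletion H) :=
  isDenseInducing_ofFun.continuous

lemma ofFun_inv (h : H) : ofFun h⁻¹ = (ofFun h)⁻¹ :=
  (isDenseInducing_ofFun.extend_eq (continuous_ofFun.comp continuous_inv) h).symm

lemma ofFun_mul (g h : H) : ofFun (g * h) = ofFun g * ofFun h :=
  ((isDenseInducing_ofFun.prodMap isDenseInducing_ofFun).extend_eq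
    (continuous_ofFun.comp continuous_mul) (g, h)).symm

noncomputable instance : Group (GroupCompletion H) where
  mul_assoc x y z := by
    refine denseRange_ofFun.induction_on₃ (isClosed_eq (by fun_prop) (by fun_prop)) ?_ x y z
    intro a b c
    simp only [← ofFun_mul, mul_assoc]
  one_mul x := by
    refine denseRange_ofFun.induction_on x (isClosed_eq (by fun_prop) (by fun_prop)) ?_
    intro a
    exact (ofFun_mul 1 a).symm.trans (by rw [one_mul])
  mul_one x := by
    refine denseRange_ofFun.induction_on x (isClosed_eq (by fun_prop) (by fun_prop)) ?_
    intro a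
    exact (ofFun_mul a 1).symm.trans (by rw [mul_one])
  inv_mul_cancel x := by
    refine denseRange_ofFun.induction_on x (isClosed_eq (by fun_prop) (by fun_prop)) ?_
    intro a
    rw [← ofFun_inv, ← ofFun_mul, inv_mul_cancel]
    rfl

instance : IsTopologicalGroup (GroupCompletion H) where

/-- The canonical homomorphism from a topological group to its completion. -/
def of : H →* GroupCompletion H where
  toFun := ofFun
  map_one' := rfl
  map_mul' := ofFun_mul

variable {H' : Type*} [Group H'] [TopologicalSpace H'] [IsTopologicalGroup H']

lemma uniformContinuous_hom (f : H →* H') (hf : Continuous f) : UniformContinuous f := by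
  have hf1 : Tendsto f (𝓝 1) (𝓝 1) := by simpa using hf.tendsto 1
  have e : uniformity H' = comap (fun p : H' × H' => p.1⁻¹ * p.2) (𝓝 1) ⊓
      comap (fun p : H' × H' => p.2 * p.1⁻¹) (𝓝 1) := rfl
  have e' : uniformity H = comap (fun p : H × H => p.1⁻¹ * p.2) (𝓝 1) ⊓
      comap (fun p : H × H => p.2 * p.1⁻¹) (𝓝 1) := rfl
  rw [UniformContinuous, e, e', tendsto_inf, tendsto_comap_iff, tendsto_comap_iff]
  constructor
  · refine Tendsto.mono_left ?_ inf_le_left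
    simpa [Function.comp_def] using hf1.comp (tendsto_comap (f := fun p : H × H => p.1⁻¹ * p.2))
  · refine Tendsto.mono_left ?_ inf_le_right
    simpa [Function.comp_def] using hf1.comp (tendsto_comap (f := fun p : H × H => p.2 * p.1⁻¹))

/-- The underlying function of `GroupCompletion.map`. -/
noncomputable def mapFun (f : H → H') : GroupCompletion H → GroupCompletion H' :=
  UniformSpace.Completion.map f

lemma continuous_mapFun (f : H → H') : Continuous (mapFun f) :=
  UniformSpace.Completion.continuous_map

lemma mapFun_ofFun (f : H →* H') (hf : Continuous f) (h : H) :
    mapFun f (ofFun h) = ofFun (f h) :=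
  UniformSpace.Completion.map_coe (uniformContinuous_hom f hf) h

/-- The homomorphism between completions which extends a continuous homomorphism `f`. -/
noncomputable def map (f : H →* H') (hf : Continuous f) :
    GroupCompletion H →* GroupCompletion H' where
  toFun := mapFun f
  map_one' := (mapFun_ofFun f hf 1).trans (by rw [map_one]; rfl)
  map_mul' x y := by
    have hc := continuous_mapFun (H := H) (H' := H') f
    refine denseRange_ofFun.induction_on₂ (isClosed_eq (by fun_prop) (by fun_prop)) ?_ x y
    intro a b
    rw [← ofFun_mul, mapFun_ofFun f hf, mapFun_ofFun f hf, mapFun_ofFun f hf, map_mul, ofFun_mul]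

end GroupCompletion

end Completion

noncomputable section ArithmeticGroups

open IsDedekindDomain NumberField Matrix

/-- The ring of `S`-integers modulo a nonzero ideal is finite. -/
lemma finite_quotient_integer {K : Type*} [Field K] [NumberField K]
    (S : Set (HeightOneSpectrum (𝓞 K))) {a : Ideal (S.integer K)} (ha : a ≠ ⊥) :
    Finite (S.integer K ⧸ a) := by
  obtain ⟨b, hb, hb0⟩ := Submodule.exists_mem_ne_zero_of_ne_bot ha
  -- a positive integer `m` in the ideal
  obtain ⟨m, hm, hma⟩ : ∃ m : ℕ, m ≠ 0 ∧ (m : S.integer K) ∈ a := by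
    obtain ⟨r, s, hs, hrs⟩ := IsFractionRing.div_surjective (A := 𝓞 K) (b : K)
    have hs0 : (algebraMap (𝓞 K) K s) ≠ 0 := by
      simpa using nonZeroDivisors.ne_zero hs
    have hr0 : r ≠ 0 := by
      rintro rfl
      apply hb0
      ext
      simp [← hrs]
    have hfin : Finite (𝓞 K ⧸ Ideal.span {r}) :=
      Ring.HasFiniteQuotients.finiteQuotient (by simpa using hr0)
    refine ⟨Nat.card (𝓞 K ⧸ Ideal.span {r}), Nat.card_pos.ne', ?_⟩
    have h1 : ((Nat.card (𝓞 K ⧸ Ideal.span {r}) : ℕ) : 𝓞 K) ∈ Ideal.span {r} := by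
      rw [← Ideal.Quotient.eq_zero_iff_mem, map_natCast, ← nsmul_one]
      exact card_nsmul_eq_zero'
    obtain ⟨c, hc⟩ := Ideal.mem_span_singleton.1 h1
    have h2 : ((Nat.card (𝓞 K ⧸ Ideal.span {r}) : ℕ) : S.integer K) =
        algebraMap (𝓞 K) (S.integer K) (s * c) * b := by
      ext
      have : ((Nat.card (𝓞 K ⧸ Ideal.span {r}) : ℕ) : K) = algebraMap (𝓞 K) K (r * c) := by
        rw [← hc, map_natCast]
      push_cast
      rw [this, ← hrs]
      simp only [map_mul]
      field_simp
    rw [h2]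
    exact a.mul_mem_left _ hb
  by_contra hinf
  rw [not_finite_iff_infinite] at hinf
  obtain ⟨t, ht⟩ := Infinite.exists_subset_card_eq (S.integer K ⧸ a)
    (m ^ Module.finrank ℚ K + 1)
  let f : t → S.integer K := fun i => Quotient.out i.1
  have hf : ∀ i : t, Ideal.Quotient.mk a (f i) = i.1 := fun i => Quotient.out_eq i.1
  let M : Submodule ℤ (S.integer K) := Submodule.span ℤ (Set.range f)
  have : Module.Finite ℤ M := Module.Finite.span_of_finite ℤ (Set.finite_range f)
  have : Module.Free ℤ M := Module.free_of_finite_type_torsion_free'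
  let B := Module.Free.chooseBasis ℤ M
  have hr : Fintype.card (Module.Free.ChooseBasisIndex ℤ M) ≤ Module.finrank ℚ K := by
    have h1 : LinearIndependent ℤ fun i => ((B i : S.integer K) : K) := by
      have := B.linearIndependent.map' ((S.integer K).val.toLinearMap.restrictScalars ℤ ∘ₗ M.subtype)
        (LinearMap.ker_eq_bot.2 (Subtype.val_injective.comp Subtype.val_injective))
      exact this
    have h2 := (LinearIndependent.iff_fractionRing ℤ ℚ).1 h1
    exact h2.fintype_card_le_finrank
  have : NeZero m := ⟨hm⟩
  let g : t → (Module.Free.ChooseBasisIndex ℤ M → ZMod m) := fun i k =>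
    (B.repr ⟨f i, Submodule.subset_span ⟨i, rfl⟩⟩ k : ZMod m)
  have hg : Function.Injective g := by
    intro i j hij
    apply Subtype.ext
    rw [← hf, ← hf, Ideal.Quotient.eq]
    set u : M := ⟨f i, Submodule.subset_span ⟨i, rfl⟩⟩ with hu
    set v : M := ⟨f j, Submodule.subset_span ⟨j, rfl⟩⟩ with hv
    have hd : ∀ k, (m : ℤ) ∣ B.repr (u - v) k := by
      intro k
      have := congrFun hij k
      rw [map_sub, Finsupp.sub_apply, ← ZMod.intCast_eq_intCast_iff_dvd_sub]
      exact this.symm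
    have : (f i - f j) = ((u - v : M) : S.integer K) := rfl
    rw [this, ← B.sum_repr (u - v), Submodule.coe_sum]
    refine Ideal.sum_mem _ fun k _ => ?_
    obtain ⟨c, hc⟩ := hd k
    rw [hc, Submodule.coe_smul, mul_smul, zsmul_eq_mul]
    simpa using a.mul_mem_right _ hma
  have := Fintype.card_le_of_injective g hg
  rw [Fintype.card_fun, ZMod.card, Fintype.card_coe, ht] at this
  have h3 := Nat.pow_le_pow_right (Nat.pos_of_ne_zero hm) hr
  omega

/-- A linear algebraic group over the field `K` together with a faithful `K`-representation of
degree `m`, i.e. (in characteristic zero) a subgroup of `GL_m` over an algebraic closure of `K`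
which is the zero set of polynomials in the matrix entries with coefficients in `K`. -/
structure LinearAlgebraicGroup (K : Type*) [Field K] (m : ℕ) where
  /-- the defining equations -/
  equations : Set (MvPolynomial (Fin m × Fin m) K)
  /-- the points over the algebraic closure -/
  geometricPoints : Subgroup (GL (Fin m) (AlgebraicClosure K))
  mem_geometricPoints (g : GL (Fin m) (AlgebraicClosure K)) : g ∈ geometricPoints ↔
    ∀ p ∈ equations, MvPolynomial.aeval (fun ij : Fin m × Fin m => g.val ij.1 ij.2) p = 0

namespace LinearAlgebraicGroup

variable {K : Type*} [Field K] {m : ℕ}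

/-- The group `G(K)` of `K`-rational points. -/
def points (G : LinearAlgebraicGroup K m) : Subgroup (GL (Fin m) K) :=
  G.geometricPoints.comap (GeneralLinearGroup.map (algebraMap K (AlgebraicClosure K)))

variable [NumberField K]

/-- `GL_m(𝒪(S), 𝔞)`, as a subgroup of `GL_m(K)`: the matrices over the ring `𝒪(S)` of `S`-integers
that are invertible over `𝒪(S)` and congruent to the identity matrix modulo `𝔞`. -/
def glCongruence (m : ℕ) (S : Set (HeightOneSpectrum (𝓞 K))) (a : Ideal (S.integer K)) :
    Subgroup (GL (Fin m) K) :=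
  (GeneralLinearGroup.map (n := Fin m) (Ideal.Quotient.mk a)).ker.map
    (GeneralLinearGroup.map (algebraMap (S.integer K) K))

variable (G : LinearAlgebraicGroup K m) (S : Set (HeightOneSpectrum (𝓞 K)))

/-- The group `Γ = G(𝒪(S)) = G(K) ∩ GL_m(𝒪(S))`. -/
def integralPoints : Subgroup G.points :=
  (GeneralLinearGroup.map (n := Fin m) (algebraMap (S.integer K) K)).range.subgroupOf G.points

/-- The congruence subgroup `G(𝒪(S), 𝔞) = G(K) ∩ GL_m(𝒪(S), 𝔞)` of level `𝔞`. -/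
def congruenceSubgroup (a : Ideal (S.integer K)) : Subgroup G.points :=
  (glCongruence m S a).subgroupOf G.points

variable {S} in
lemma mem_glCongruence {a : Ideal (S.integer K)} (g : GL (Fin m) K) :
    g ∈ glCongruence m S a ↔ ∀ i j,
      (g.val - 1) i j ∈ Submodule.map (Algebra.linearMap (S.integer K) K) a ∧
      (g⁻¹.val - 1) i j ∈ Submodule.map (Algebra.linearMap (S.integer K) K) a := by
  have key : ∀ u : GL (Fin m) (S.integer K),
      u ∈ (GeneralLinearGroup.map (n := Fin m) (Ideal.Quotient.mk a)).ker →
      ∀ i j, (((GeneralLinearGroup.map (algebraMap (S.integer K) K) u).val - 1 :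
        Matrix (Fin m) (Fin m) K) i j) ∈ Submodule.map (Algebra.linearMap (S.integer K) K) a := by
    intro u hu i j
    refine ⟨(u.val - 1) i j, ?_, ?_⟩
    · have := congrArg (fun v : GL (Fin m) (S.integer K ⧸ a) => v.val i j) hu
      rw [SetLike.mem_coe, ← Ideal.Quotient.eq_zero_iff_mem, Matrix.sub_apply, map_sub, sub_eq_zero]
      refine this.trans ?_
      simp [one_apply]
    · simp only [Algebra.linearMap_apply, Matrix.sub_apply, map_sub, one_apply]
      split_ifs <;> simp
  constructor
  · rintro ⟨u, hu, rfl⟩ i j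
    refine ⟨key u hu i j, ?_⟩
    rw [← map_inv]
    exact key u⁻¹ (inv_mem hu) i j
  · intro h
    choose f hf hf' using fun i j => (h i j).1
    choose f' hg hg' using fun i j => (h i j).2
    have e1 : (1 + Matrix.of f).map (algebraMap (S.integer K) K) = g.val := by
      ext i j
      have := hf' i j
      rw [Algebra.linearMap_apply, Matrix.sub_apply] at this
      rw [map_apply, Matrix.add_apply, map_add, of_apply, this]
      simp [one_apply]
    have e2 : (1 + Matrix.of f').map (algebraMap (S.integer K) K) = g⁻¹.val := by
      ext i j
      have := hg' i j
      rw [Algebra.linearMap_apply, Matrix.sub_apply] at this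
      rw [map_apply, Matrix.add_apply, map_add, of_apply, this]
      simp [one_apply]
    have hinj : Function.Injective fun M : Matrix (Fin m) (Fin m) (S.integer K) =>
        M.map (algebraMap (S.integer K) K) :=
      Matrix.map_injective (FaithfulSMul.algebraMap_injective _ _)
    refine ⟨⟨1 + Matrix.of f, 1 + Matrix.of f', hinj ?_, hinj ?_⟩, ?_, ?_⟩
    · simp only [Matrix.map_mul, e1, e2, Matrix.map_one _ (map_zero _) (map_one _)]
      simp
    · simp only [Matrix.map_mul, e1, e2, Matrix.map_one _ (map_zero _) (map_one _)]
      simp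
    · apply Units.ext
      ext i j
      have : Ideal.Quotient.mk a (f i j) = 0 := Ideal.Quotient.eq_zero_iff_mem.2 (hf i j)
      simp [this, one_apply]
    · exact Units.ext e1

lemma congruenceSubgroup_mono {a b : Ideal (S.integer K)} (h : a ≤ b) :
    G.congruenceSubgroup S a ≤ G.congruenceSubgroup S b := by
  intro x hx
  have hx' := (mem_glCongruence x.1).1 hx
  exact (mem_glCongruence x.1).2 fun i j =>
    ⟨Submodule.map_mono h (hx' i j).1, Submodule.map_mono h (hx' i j).2⟩

lemma congruenceSubgroup_le (a : Ideal (S.integer K)) :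
    G.congruenceSubgroup S a ≤ G.integralPoints S := by
  rintro x ⟨u, -, hu⟩
  exact ⟨u, hu⟩

lemma congruenceSubgroup_top : G.congruenceSubgroup S ⊤ = G.integralPoints S := by
  refine le_antisymm (G.congruenceSubgroup_le S ⊤) ?_
  rintro x ⟨u, hu⟩
  refine ⟨u, ?_, hu⟩
  apply Units.ext
  ext i j
  have : Subsingleton (S.integer K ⧸ (⊤ : Ideal (S.integer K))) :=
    Ideal.Quotient.subsingleton_iff.2 rfl
  exact Subsingleton.elim _ _

/-- The congruence subgroups have finite index. -/
lemma relIndex_congruenceSubgroup {a : Ideal (S.integer K)} (ha : a ≠ ⊥) :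
    (G.congruenceSubgroup S a).relIndex (G.integralPoints S) ≠ 0 := by
  have := finite_quotient_integer S ha
  refine Subgroup.relIndex_comap_ne_zero _ ?_
  have hinj : Function.Injective
      (GeneralLinearGroup.map (n := Fin m) (algebraMap (S.integer K) K)) :=
    Units.map_injective (Matrix.map_injective (FaithfulSMul.algebraMap_injective _ _))
  rw [glCongruence, MonoidHom.range_eq_map, Subgroup.relIndex_map_map_of_injective _ _ hinj,
    Subgroup.relIndex_ker]
  have : Finite (GL (Fin m) (S.integer K ⧸ a)) :=
    Finite.of_injective _ Units.val_injective
  exact Nat.card_pos.ne'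

/-- Conjugation by a rational point is continuous for the congruence topology. -/
lemma exists_conj_congruenceSubgroup (x : G.points) {a : Ideal (S.integer K)} (ha : a ≠ ⊥) :
    ∃ b : Ideal (S.integer K), b ≠ ⊥ ∧
      ∀ y ∈ G.congruenceSubgroup S b, x * y * x⁻¹ ∈ G.congruenceSubgroup S a := by
  classical
  obtain ⟨d, hd⟩ := IsLocalization.exist_integer_multiples_of_finset (nonZeroDivisors (𝓞 K))
    ((Finset.univ.image fun ij : Fin m × Fin m => x.1.val ij.1 ij.2) ∪
      (Finset.univ.image fun ij : Fin m × Fin m => x.1⁻¹.val ij.1 ij.2))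
  set D : S.integer K := algebraMap (𝓞 K) (S.integer K) d with hD
  have hD0 : D ≠ 0 := by
    rw [hD, Ne, FaithfulSMul.algebraMap_eq_zero_iff]
    exact nonZeroDivisors.ne_zero d.2
  have hint : ∀ z : K, IsLocalization.IsInteger (𝓞 K) ((d : 𝓞 K) • z) →
      ∃ c : S.integer K, (c : K) = D * z := by
    rintro z ⟨c, hc⟩
    refine ⟨algebraMap _ _ c, ?_⟩
    rw [Algebra.smul_def] at hc
    exact hc
  have h1 : ∀ i j, ∃ c : S.integer K, (c : K) = D * x.1.val i j := fun i j =>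
    hint _ (hd _ (Finset.mem_union_left _ (Finset.mem_image_of_mem
      (fun ij : Fin m × Fin m => x.1.val ij.1 ij.2) (Finset.mem_univ (i, j)))))
  have h2 : ∀ i j, ∃ c : S.integer K, (c : K) = D * x.1⁻¹.val i j := fun i j =>
    hint _ (hd _ (Finset.mem_union_right _ (Finset.mem_image_of_mem
      (fun ij : Fin m × Fin m => x.1⁻¹.val ij.1 ij.2) (Finset.mem_univ (i, j)))))
  choose p hp using h1
  choose q hq using h2
  have main : ∀ M : Matrix (Fin m) (Fin m) K, (∀ i j, M i j ∈
      Submodule.map (Algebra.linearMap (S.integer K) K) (Ideal.span {D * D} * a)) → ∀ i j,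
      (x.1.val * M * x.1⁻¹.val) i j ∈ Submodule.map (Algebra.linearMap (S.integer K) K) a := by
    intro M hM i j
    rw [mul_apply]
    refine Submodule.sum_mem _ fun k _ => ?_
    rw [mul_apply, Finset.sum_mul]
    refine Submodule.sum_mem _ fun l _ => ?_
    obtain ⟨c, hc, hcM⟩ := hM l k
    obtain ⟨c', hc', rfl⟩ := Ideal.mem_span_singleton_mul.1 hc
    refine ⟨p i l * q k j * c', a.mul_mem_left _ hc', ?_⟩
    rw [← hcM]
    simp only [Algebra.linearMap_apply, map_mul]
    have e1 : algebraMap (S.integer K) K (p i l) = algebraMap (S.integer K) K D * x.1.val i l :=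
      hp i l
    have e2 : algebraMap (S.integer K) K (q k j) = algebraMap (S.integer K) K D * x.1⁻¹.val k j :=
      hq k j
    rw [e1, e2]
    ring
  refine ⟨Ideal.span {D * D} * a, ?_, fun y hy => ?_⟩
  · simp [ha, hD0]
  · have hy' := (mem_glCongruence y.1).1 hy
    refine (mem_glCongruence _).2 fun i j => ⟨?_, ?_⟩
    · have := main _ (fun i j => (hy' i j).1) i j
      rw [mul_sub, sub_mul, mul_one, ← Units.val_mul x.1 x.1⁻¹, mul_inv_cancel] at this
      exact this
    · have := main _ (fun i j => (hy' i j).2) i j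
      rw [mul_sub, sub_mul, mul_one, ← Units.val_mul x.1 x.1⁻¹, mul_inv_cancel,
        ← Units.val_mul, ← Units.val_mul] at this
      have e : ((x * y * x⁻¹ : G.points) : GL (Fin m) K)⁻¹ = x.1 * y.1⁻¹ * x.1⁻¹ := by
        simp [mul_assoc]
      change (((x * y * x⁻¹ : G.points) : GL (Fin m) K)⁻¹.val - 1 : Matrix (Fin m) (Fin m) K) i j ∈ _
      rw [e]
      exact this

/-- The finite index subgroups of `Γ`, as a fundamental system of neighbourhoods of the identity
in `G(K)`. -/
abbrev arithmeticBasis : GroupFilterBasis G.points where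
  sets := {U | ∃ N : Subgroup G.points, N ≤ G.integralPoints S ∧
    N.relIndex (G.integralPoints S) ≠ 0 ∧ U = N}
  nonempty := ⟨_, G.integralPoints S, le_rfl, by simp, rfl⟩
  inter_sets := by
    rintro _ _ ⟨N, hN, hN', rfl⟩ ⟨M, hM, hM', rfl⟩
    exact ⟨_, ⟨N ⊓ M, inf_le_left.trans hN, Subgroup.relIndex_inf_ne_zero hN' hM', rfl⟩, by simp⟩
  one' := by
    rintro _ ⟨N, -, -, rfl⟩
    exact N.one_mem
  mul' := by
    rintro _ ⟨N, hN, hN', rfl⟩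
    exact ⟨_, ⟨N, hN, hN', rfl⟩, by simp⟩
  inv' := by
    rintro _ ⟨N, hN, hN', rfl⟩
    exact ⟨_, ⟨N, hN, hN', rfl⟩, fun y hy => N.inv_mem hy⟩
  conj' := by
    rintro x _ ⟨N, hN, hN', rfl⟩
    obtain ⟨b, hb, hb'⟩ := G.exists_conj_congruenceSubgroup S x (a := ⊤) top_ne_bot
    rw [congruenceSubgroup_top] at hb'
    let c : G.points →* G.points := (MulAut.conj x).toMonoidHom
    refine ⟨_, ⟨N.comap c ⊓ G.integralPoints S, inf_le_right, ?_, rfl⟩, fun y hy => hy.1⟩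
    rw [Subgroup.inf_relIndex_right]
    refine Subgroup.relIndex_ne_zero_trans (Subgroup.relIndex_comap_ne_zero c hN') ?_
    intro h0
    exact G.relIndex_congruenceSubgroup S hb
      (Subgroup.relIndex_eq_zero_of_le_left (fun y hy => hb' y hy) h0)

/-- The congruence subgroups, as a fundamental system of neighbourhoods of the identity
in `G(K)`. -/
abbrev congruenceBasis : GroupFilterBasis G.points where
  sets := {U | ∃ a : Ideal (S.integer K), a ≠ ⊥ ∧ U = G.congruenceSubgroup S a}
  nonempty := ⟨_, ⊤, top_ne_bot, rfl⟩
  inter_sets := by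
    rintro _ _ ⟨a, ha, rfl⟩ ⟨b, hb, rfl⟩
    have hab : a * b ≠ ⊥ := by simp [ha, hb]
    refine ⟨G.congruenceSubgroup S (a * b), ⟨a * b, hab, rfl⟩, Set.subset_inter ?_ ?_⟩
    · exact G.congruenceSubgroup_mono S Ideal.mul_le_left
    · exact G.congruenceSubgroup_mono S Ideal.mul_le_right
  one' := by
    rintro _ ⟨a, -, rfl⟩
    exact one_mem _
  mul' := by
    rintro _ ⟨a, ha, rfl⟩
    exact ⟨_, ⟨a, ha, rfl⟩, by simp⟩
  inv' := by
    rintro _ ⟨a, ha, rfl⟩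
    exact ⟨_, ⟨a, ha, rfl⟩, fun y hy => (G.congruenceSubgroup S a).inv_mem hy⟩
  conj' := by
    rintro x _ ⟨a, ha, rfl⟩
    obtain ⟨b, hb, hb'⟩ := G.exists_conj_congruenceSubgroup S x ha
    exact ⟨_, ⟨b, hb, rfl⟩, hb'⟩

/-- The `S`-arithmetic topology on `G(K)`. -/
abbrev arithmeticTopology : TopologicalSpace G.points := (G.arithmeticBasis S).topology

/-- The `S`-congruence topology on `G(K)`. -/
abbrev congruenceTopology : TopologicalSpace G.points := (G.congruenceBasis S).topology

/-- The completion of `G(K)` for the `S`-arithmetic topology. -/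
abbrev ArithmeticCompletion : Type _ :=
  @GroupCompletion G.points _ (G.arithmeticTopology S) (G.arithmeticBasis S).isTopologicalGroup

/-- The completion of `G(K)` for the `S`-congruence topology. -/
abbrev CongruenceCompletion : Type _ :=
  @GroupCompletion G.points _ (G.congruenceTopology S) (G.congruenceBasis S).isTopologicalGroup

/-- The canonical map from `G(K)` to its `S`-congruence completion. -/
def toCongruenceCompletion : G.points →* G.CongruenceCompletion S :=
  @GroupCompletion.of G.points _ (G.congruenceTopology S) (G.congruenceBasis S).isTopologicalGroup

/-- The `S`-arithmetic topology is finer than the `S`-congruence topology. -/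
lemma continuous_id_arithmetic_congruence :
    @Continuous _ _ (G.arithmeticTopology S) (G.congruenceTopology S) (MonoidHom.id G.points) := by
  refine @continuous_of_tendsto_nhds_one G.points (G.arithmeticTopology S) _
    (G.arithmeticBasis S).isTopologicalGroup _ _ _ (G.congruenceTopology S)
    (G.congruenceBasis S).isTopologicalGroup.toContinuousMul _ _ (MonoidHom.id G.points) ?_
  rw [(G.arithmeticBasis S).nhds_one_hasBasis.tendsto_iff (G.congruenceBasis S).nhds_one_hasBasis]
  rintro _ ⟨a, ha, rfl⟩
  exact ⟨_, ⟨_, G.congruenceSubgroup_le S a, G.relIndex_congruenceSubgroup S ha, rfl⟩,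
    fun x hx => hx⟩

/-- The canonical homomorphism `π` from the `S`-arithmetic to the `S`-congruence completion: the
continuous extension of the identity map of `G(K)`. -/
def completionMap : G.ArithmeticCompletion S →* G.CongruenceCompletion S :=
  @GroupCompletion.map G.points _ (G.arithmeticTopology S) (G.arithmeticBasis S).isTopologicalGroup
    G.points _ (G.congruenceTopology S) (G.congruenceBasis S).isTopologicalGroup
    (MonoidHom.id G.points) (G.continuous_id_arithmetic_congruence S)

/-- The congruence kernel `C^S(G) = ker π`. -/
def congruenceKernel : Subgroup (G.ArithmeticCompletion S) :=
  (G.completionMap S).ker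

/-- For a subgroup `N` of `Γ`, the set `N̄ ∩ Γ`, where `N̄` is the closure of `N` in the
`S`-congruence completion. -/
def closureInter (N : Subgroup (G.integralPoints S)) : Set (G.integralPoints S) :=
  {γ | G.toCongruenceCompletion S γ ∈
    closure ((fun ν : G.integralPoints S => G.toCongruenceCompletion S ν) '' N)}

end LinearAlgebraicGroup

end ArithmeticGroups

/-- `Z(N, y)`, the set of all `t` whose commutator with `y` lies in `N`. -/
def centralizerMod {Γ : Type*} [Group Γ] (N : Subgroup Γ) (y : Γ) : Set Γ :=
  {t | y * t * y⁻¹ * t⁻¹ ∈ N}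

open IsDedekindDomain NumberField
open scoped Pointwise

/-! Fix `x` in the kernel of `π` and a single `g` in `Γ` that lies in all the products `Z(N, y) (N̄
∩ Γ)`; here `g` will be an `n`-th power. Elements of `G(K)` close to `x` give, for each finite index
normal subgroup `N`, some `y_N` in `Γ` with `y_N⁻¹ x` in the arithmetic closure of `N`. Since `π x =
1`, the same `y_N` also lies in the congruence closure of `N` (`exists_approx`), so the hypothesis
applies to it: `g = t_N c_N` with `[y_N, t_N] ∈ N` and `c_N ∈ N̄ ∩ Γ`.

Now let `N` shrink. Then `y_N → x` and `[y_N, t_N] → 1` in the arithmetic completion, and `c_N → 1`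
in the congruence completion (`tendsto_one_of_mem_closure`). The `t_N` are chosen independently of
one another and need not converge, but finiteness of the quotients `Γ ⧸ N` forces convergence along
an ultrafilter (`exists_tendsto_ultrafilter`). The limit `z` satisfies `[x, z] = 1` and `π z = lim g
c_N⁻¹ = g`.

The argument uses no arithmetic beyond the two topologies, so `exists_mem_centralizer_map_eq`
carries it out for a continuous homomorphism of topological groups. -/

instance Subgroup.isCodirectedOrder_normal_finiteIndex {H : Type*} [Group H] :
    IsCodirectedOrder {N : Subgroup H // N.Normal ∧ N.FiniteIndex} where
  directed M N :=
    ⟨⟨M.1 ⊓ N.1, have := M.2.1; have := N.2.1; inferInstance,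
      have := M.2.2; have := N.2.2; inferInstance⟩,
      (inf_le_left : M.1 ⊓ N.1 ≤ M.1), (inf_le_right : M.1 ⊓ N.1 ≤ N.1)⟩

/-! ### Limits over the finite index normal subgroups -/

namespace GroupCompletion

open Filter Topology

/-- Elements of the closures of the images of smaller and smaller finite index subgroups tend to
the identity. -/
lemma tendsto_one_of_mem_closure {H : Type*} [Group H] [TopologicalSpace H]
    {Γ : Subgroup H}
    (hb : ∀ U ∈ 𝓝 (1 : H), ∃ N : Subgroup Γ, N.Normal ∧ N.FiniteIndex ∧ ∀ ν ∈ N, (ν : H) ∈ U)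
    {L : Type*} [Group L] [TopologicalSpace L] [IsTopologicalGroup L]
    (k : H →* L) (hk : Continuous k) (c : {N : Subgroup Γ // N.Normal ∧ N.FiniteIndex} → L)
    (hc : ∀ N, c N ∈ closure ((fun ν : Γ => k ν) '' N.1)) :
    Tendsto c atBot (𝓝 1) := by
  -- Topological groups are regular, so closed neighbourhoods suffice; a closed `W` containing the
  -- image of `N` also contains its closure.
  rw [(closed_nhds_basis (1 : L)).tendsto_right_iff]
  rintro W ⟨hW, hWc⟩
  obtain ⟨N, hN, hfin, hNW⟩ := hb (k ⁻¹' W) (hk.continuousAt (by simpa using hW))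
  filter_upwards [Iic_mem_atBot ⟨N, hN, hfin⟩] with M hM
  refine closure_minimal ?_ hWc (hc M)
  rintro _ ⟨ν, hν, rfl⟩
  exact hNW ν (hM hν)

section

variable {H : Type*} [Group H] [TopologicalSpace H] [IsTopologicalGroup H]

attribute [local instance] twoSidedUniformSpace

lemma isInducing_ofFun : IsInducing (ofFun : H → GroupCompletion H) :=
  isDenseInducing_ofFun.isInducing

/-- An ultrafilter of elements of `Γ` converges in the completion, provided that the finite index
subgroups of `Γ` are a basis of neighbourhoods of the identity. -/
lemma exists_tendsto_ultrafilter {Γ : Subgroup H}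
    (hb : ∀ U ∈ 𝓝 (1 : H), ∃ N : Subgroup Γ, N.Normal ∧ N.FiniteIndex ∧ ∀ ν ∈ N, (ν : H) ∈ U)
    {ι : Type*} (F : Ultrafilter ι) (t : ι → Γ) :
    ∃ z, Tendsto (fun i => ofFun (t i : H)) F (𝓝 z) := by
  refine exists_tendsto (f := fun i => (t i : H)) ((cauchy_iff' _).2 ⟨inferInstance, ?_⟩)
  have key : ∀ U ∈ 𝓝 (1 : H), ∃ N : Subgroup Γ, N.Normal ∧ (∀ ν ∈ N, (ν : H) ∈ U) ∧
      ∀ᶠ p : ι × ι in (F : Filter ι) ×ˢ F, (t p.1)⁻¹ * t p.2 ∈ N := by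
    intro U hU
    obtain ⟨N, hN, hfin, hNU⟩ := hb U hU
    refine ⟨N, hN, hNU, ?_⟩
    have : Finite (Γ ⧸ N) := inferInstance
    -- The finitely many cosets of `N` partition the index set, and an ultrafilter selects exactly
    -- one piece.
    obtain ⟨q, -, hq⟩ := (Ultrafilter.eventually_exists_mem_iff (f := F)
      (is := (Set.univ : Set (Γ ⧸ N))) (P := fun q i => (t i : Γ ⧸ N) = q)
      Set.finite_univ).1 (Eventually.of_forall fun i => ⟨_, Set.mem_univ _, rfl⟩)
    filter_upwards [hq.prod_mk hq] with p hp
    exact QuotientGroup.eq.1 (hp.1.trans hp.2.symm)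
  rw [prod_map_map_eq, tendsto_map'_iff, tendsto_map'_iff]
  constructor <;> intro U hU <;> obtain ⟨N, hN, hNU, hev⟩ := key U hU <;> rw [mem_map]
  · filter_upwards [hev] with p hp using hNU _ hp
  -- The two-sided uniformity also requires right quotients to be small; normality of `N` converts
  -- left quotients into right ones.
  · filter_upwards [hev] with p hp using hNU _ (hN.mem_comm hp)

end

/-! ### Approximating and lifting through a map of completions -/

section

variable {H : Type*} [Group H] [TopologicalSpace H] [IsTopologicalGroup H]
  {H' : Type*} [Group H'] [TopologicalSpace H'] [IsTopologicalGroup H']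

/-- An element of the kernel of the map of completions is approximated, modulo any finite index
normal subgroup `N` of `Γ`, by elements of `Γ` in the closure of `N`. -/
lemma exists_approx {Γ : Subgroup H}
    (hb : ∀ N : Subgroup Γ, N.FiniteIndex → ((↑) '' (N : Set Γ) : Set H) ∈ 𝓝 1)
    (f : H →* H') (hf : Continuous f) (hΓ : ∃ V ∈ 𝓝 (1 : H'), f ⁻¹' V ⊆ Γ)
    {x : GroupCompletion H} (hx : map f hf x = 1) (N : Subgroup Γ) (hN : N.FiniteIndex) :
    ∃ y : Γ, of (f y) ∈ closure ((fun ν : Γ => of (f ν)) '' (N : Set Γ)) ∧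
      (of (y : H))⁻¹ * x ∈ closure ((fun ν : Γ => of (ν : H)) '' (N : Set Γ)) := by
  have hF := (cauchy_iff' _).1 (cauchy_comap_ofFun x)
  set F : Filter H := comap ofFun (𝓝 x)
  obtain ⟨hne, hleft, -⟩ := hF
  have hofF : Tendsto (fun y : H => of y) F (𝓝 x) := tendsto_comap
  have hfF : Tendsto (fun y : H => of (f y)) F (𝓝 1) := by
    have := ((continuous_mapFun (f : H → H')).tendsto x).comp hofF
    rw [show mapFun f x = 1 from hx] at this
    exact this.congr fun y => mapFun_ofFun f hf y
  -- `f y` tends to `1` in the completion of `H'`, hence already in `H'`, whose topology is induced;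
  -- openness of `Γ` there puts `y` in `Γ`.
  have hmem : ∀ᶠ y in F, y ∈ Γ := by
    obtain ⟨V, hV, hVΓ⟩ := hΓ
    rw [isInducing_ofFun.nhds_eq_comap] at hV
    filter_upwards [tendsto_comap_iff.2 hfF hV] with y hy using hVΓ hy
  have hdiv : ∀ᶠ p : H × H in F ×ˢ F, p.1⁻¹ * p.2 ∈ ((↑) '' (N : Set Γ) : Set H) :=
    hleft (hb N hN)
  -- One fixed `y` near `x` such that `y⁻¹ y' ∈ N` for all `y'` sufficiently near `x`. Letting `y'`
  -- tend to `x` gives both claims: `y'⁻¹ y` tends to `y` after applying `f`, and `y⁻¹ y'` tends to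
  -- `y⁻¹ x`.
  obtain ⟨y, hyΓ, hy⟩ := (hmem.and hdiv.curry).exists
  refine ⟨⟨y, hyΓ⟩, ?_, ?_⟩
  · have hlim : Tendsto (fun y' => of (f (y'⁻¹ * y))) F (𝓝 (of (f y))) := by
      have := hfF.inv.mul_const (of (f y))
      simpa using this
    refine mem_closure_of_tendsto hlim ?_
    filter_upwards [hy] with y' ⟨ν, hν, e⟩
    refine ⟨ν⁻¹, N.inv_mem hν, ?_⟩
    have e' : ((ν⁻¹ : Γ) : H) = y'⁻¹ * y := by rw [Subgroup.coe_inv, e]; group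
    simp only [e']
  · have hlim : Tendsto (fun y' => of (y⁻¹ * y')) F (𝓝 ((of y)⁻¹ * x)) := by
      simpa using hofF.const_mul (of y)⁻¹
    refine mem_closure_of_tendsto hlim ?_
    filter_upwards [hy] with y' ⟨ν, hν, e⟩
    exact ⟨ν, hν, by simp only [e]⟩

/-- If `g` lies in `Z(N, y) (N̄ ∩ Γ)` for all finite index normal subgroups `N` of `Γ` and all `y`
in `N̄ ∩ Γ`, then the image of `g` lifts to the centralizer of any given element of the kernel of
the map of completions. -/
theorem exists_mem_centralizer_map_eq {Γ : Subgroup H}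
    (hb : (𝓝 (1 : H)).HasBasis (fun N : Subgroup H => N ≤ Γ ∧ N.relIndex Γ ≠ 0) fun N => N)
    (f : H →* H') (hf : Continuous f) (hΓ : ∃ V ∈ 𝓝 (1 : H'), f ⁻¹' V ⊆ Γ) (g : Γ)
    (h : ∀ N : Subgroup Γ, N.Normal → N.FiniteIndex →
      ∀ y : Γ, of (f y) ∈ closure ((fun ν : Γ => of (f ν)) '' (N : Set Γ)) →
      ∃ t c : Γ, y * t * y⁻¹ * t⁻¹ ∈ N ∧
        of (f c) ∈ closure ((fun ν : Γ => of (f ν)) '' (N : Set Γ)) ∧ t * c = g)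
    {x : GroupCompletion H} (hx : map f hf x = 1) :
    ∃ z ∈ Subgroup.centralizer {x}, map f hf z = of (f g) := by
  have hb₁ : ∀ U ∈ 𝓝 (1 : H), ∃ N : Subgroup Γ,
      N.Normal ∧ N.FiniteIndex ∧ ∀ ν ∈ N, (ν : H) ∈ U := by
    intro U hU
    obtain ⟨N, ⟨-, hN⟩, hNU⟩ := hb.mem_iff.1 hU
    have : (N.subgroupOf Γ).FiniteIndex := ⟨hN⟩
    -- The normal core of a finite index subgroup still has finite index.
    exact ⟨(N.subgroupOf Γ).normalCore, inferInstance, inferInstance,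
      fun ν hν => hNU ((N.subgroupOf Γ).normalCore_le hν)⟩
  have hb₂ : ∀ N : Subgroup Γ, N.FiniteIndex → ((↑) '' (N : Set Γ) : Set H) ∈ 𝓝 1 := by
    intro N hN
    refine hb.mem_iff.2 ⟨N.map Γ.subtype, ⟨Subgroup.map_subtype_le N, ?_⟩, subset_rfl⟩
    rw [Subgroup.relIndex, Subgroup.subgroupOf, Subgroup.comap_map_eq_self_of_injective
      Γ.subtype_injective]
    exact hN.index_ne_zero
  have hcof : Continuous (of : H →* GroupCompletion H) := continuous_ofFun
  have hcof' : Continuous ((of : H' →* GroupCompletion H').comp f) := continuous_ofFun.comp hf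
  let I := {N : Subgroup Γ // N.Normal ∧ N.FiniteIndex}
  have : Nonempty I := ⟨⟨⊤, inferInstance, inferInstance⟩⟩
  choose y hy hyx using fun N : I => exists_approx hb₂ f hf hΓ hx N.1 N.2.2
  choose t c hyt hc htc using fun N : I => h N.1 N.2.1 N.2.2 (y N) (hy N)
  -- `atBot` describes shrinking `N`. It is a proper filter because the index set is nonempty and
  -- closed under finite intersections.
  let F : Ultrafilter I := Ultrafilter.of atBot
  have hF : (F : Filter I) ≤ atBot := Ultrafilter.of_le _
  obtain ⟨z, hz⟩ : ∃ z, Tendsto (fun N => of (t N : H)) F (𝓝 z) :=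
    exists_tendsto_ultrafilter hb₁ F t
  -- Write `y_N = x (y_N⁻¹ x)⁻¹`, where the factor in parentheses tends to `1`.
  have hyF : Tendsto (fun N => of (y N : H)) F (𝓝 x) := by
    have := ((tendsto_one_of_mem_closure hb₁ of hcof _ hyx).mono_left hF).inv.const_mul x
    simpa using this
  have hcomm : Tendsto (fun N => of (y N * t N * (y N)⁻¹ * (t N)⁻¹ : H)) F (𝓝 1) :=
    (tendsto_one_of_mem_closure hb₁ of hcof _ fun N =>
      subset_closure ⟨_, hyt N, by simp⟩).mono_left hF
  have hcF : Tendsto (fun N => of (f (c N))) F (𝓝 1) :=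
    (tendsto_one_of_mem_closure hb₁ (of.comp f) hcof' _ hc).mono_left hF
  refine ⟨z, ?_, ?_⟩
  · have hlim : Tendsto (fun N => of (y N * t N * (y N)⁻¹ * (t N)⁻¹ : H)) F
        (𝓝 (x * z * x⁻¹ * z⁻¹)) := by
      simpa using ((hyF.mul hz).mul hyF.inv).mul hz.inv
    have e := tendsto_nhds_unique hlim hcomm
    rw [Subgroup.mem_centralizer_singleton_iff]
    rw [mul_inv_eq_one, mul_inv_eq_iff_eq_mul] at e
    exact e.symm
  · have h1 : Tendsto (fun N => of (f (t N))) F (𝓝 (map f hf z)) :=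
      (((continuous_mapFun (f : H → H')).tendsto z).comp hz).congr
        fun N => mapFun_ofFun f hf (t N)
    -- Here `t_N = g c_N⁻¹`, and the images of the `c_N` tend to `1`.
    have h2 : Tendsto (fun N => of (f (t N))) F (𝓝 (of (f g))) := by
      have := hcF.inv.const_mul (of (f g))
      rw [inv_one, mul_one] at this
      refine this.congr fun N => ?_
      rw [← htc N]
      simp
    exact tendsto_nhds_unique h1 h2

end

end GroupCompletion

/-! ### The case of the arithmetic and congruence topologies -/

theorem proposition2p3 {K : Type*} [Field K] [NumberField K] {m : ℕ}
    (G : LinearAlgebraicGroup K m) (S : Set (HeightOneSpectrum (𝓞 K))) (n : ℕ) (hn : 1 ≤ n)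
    (h : ∀ N : Subgroup (G.integralPoints S), N.Normal → N.FiniteIndex →
      ∀ y ∈ G.closureInter S N,
        Set.range (fun γ : G.integralPoints S => γ ^ n) ⊆
          centralizerMod N y * G.closureInter S N) :
    ∀ x ∈ G.congruenceKernel S,
      Set.range (fun γ : G.integralPoints S => G.toCongruenceCompletion S (γ ^ n)) ⊆
        (Subgroup.centralizer {x}).map (G.completionMap S) := by
  rintro x hx _ ⟨γ, rfl⟩
  refine @GroupCompletion.exists_mem_centralizer_map_eq G.points _ (G.arithmeticTopology S)
    (G.arithmeticBasis S).isTopologicalGroup G.points _ (G.congruenceTopology S)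
    (G.congruenceBasis S).isTopologicalGroup (G.integralPoints S) ?_ (MonoidHom.id G.points)
    (G.continuous_id_arithmetic_congruence S) ?_ (γ ^ n) ?_ x hx
  · refine (G.arithmeticBasis S).nhds_one_hasBasis.to_hasBasis ?_ ?_
    · rintro _ ⟨N, hN, hN', rfl⟩
      exact ⟨N, ⟨hN, hN'⟩, subset_rfl⟩
    · rintro N ⟨hN, hN'⟩
      exact ⟨N, ⟨N, hN, hN', rfl⟩, subset_rfl⟩
  -- The level `⊤` imposes no congruence condition, so this neighbourhood is `Γ` itself.
  · refine ⟨G.congruenceSubgroup S ⊤,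
      (G.congruenceBasis S).nhds_one_hasBasis.mem_of_mem ⟨⊤, top_ne_bot, rfl⟩, ?_⟩
    exact G.congruenceSubgroup_le S ⊤
  · intro N hN hfin y hy
    obtain ⟨t, ht, c, hc, e⟩ := h N hN hfin y hy ⟨γ, rfl⟩
    exact ⟨t, c, ht, hc, e⟩
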